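/- Let $M$ be a matroid of rank $r$ on a finite ground set $S$ which is transversal with presentation $(A_1,\dots,A_r)$, $A_j\subseteq S$; that is, the bases of $M$ are the sets of elements of $S$ covered by the maximum matchings of the bipartite graph on $S\sqcup[r]$ with edges $(x,j)$, $x\in A_j$. For $I\subseteq[r]$ let $l_I$ be the number of $x\in S$ with $\{j : x\in A_j\}=I$. For $J\subseteq\{0,1,\dots,r\}$ let $\Delta_J\subset\mathbb R^r$ be the convex hull of the points $e_j$, $j\in J$, where $e_0$ is the origin and $e_1,\dots,e_r$ are the unit vectors. The transversalhedron is the Minkowski sum $P_M=\sum_{I\subseteq[r]} l_I\,\Delta_{\{0\}\cup I}$; let $I_1,\dots,I_m$ be the sets $I$ with $l_I>0$. A Minkowski cell of a Minkowski sum $P_1+\dots+P_m$ of dimension $d$ is a polytope $B_1+\dots+B_m$ of dimension $d$ (given with its summands) where each $B_i$ is the convex hull of a nonempty set of vertices of $P_i$. A fine mixed subdivision is a set of Minkowski cells, pairwise distinct as polytopes, whose union is $P_1+\dots+P_m$, such that any two cells intersect in a (possibly empty) common face, and such that in each cell all $B_i$ are simplices with $\sum_i\dim B_i=d$. For $P_M=\sum_i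 l_{I_i}\Delta_{\{0\}\cup I_i}$, the cells of a fine mixed subdivision have the form $\Pi_{\mathcal J}=\sum_i l_{I_i}\Delta_{J_i}$ with $\emptyset\ne J_i\subseteq\{0\}\cup I_i$, and the bipartite graph $G_{\mathcal J}$ with left vertices $1,\dots,m$, right vertices $0,1,\dots,r$ and edges $(i,j)$ for $j\in J_i$ is a tree. If $0\in J_i$ put $t_i=0$; if $0\notin J_i$ let $t_i$ be the unique element of $J_i$ that is joined to the right vertex $0$ by a path of $G_{\mathcal J}$ not passing through the left vertex $i$. A lattice point of $l_{I_i}\Delta_{J_i}$ is good if it lies on none of the faces $l_{I_i}\Delta_{J_i\setminus\{j\}}$ with $j\in J_i\setminus\{t_i\}$. A lattice point of $\Pi_{\mathcal J}$ is good if it is a sum $p_1+\dots+p_m$ in which each $p_i$ is a good lattice point of $l_{I_i}\Delta_{J_i}$. Proposition. Fix any fine mixed subdivision of $P_M$, and let $p\in\mathbb Z^r$ be a lattice point of $P_M$ that lies on none of the coordinate hyperplanes $x_k=0$, $k=1,\dots,r$. Then $p$ is a good lattice point of exactly one cell of the subdivision. -/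

import Mathlib

open scoped Pointwise

/-! ### Mixed subdivisions of Minkowski sums -/

namespace MixedSubdivision

variable {E : Type*} [AddCommGroup E] [Module ℝ E]

/-- The dimension of a (nonempty) polytope: the dimension of its affine span. -/
noncomputable def dim (X : Set E) : ℕ :=
  Module.finrank ℝ (vectorSpan ℝ X)

/-- A simplex: the convex hull of a nonempty affinely independent set of points. -/
def IsSimplex (X : Set E) : Prop :=
  ∃ V : Set E, V.Nonempty ∧ AffineIndependent ℝ ((↑) : V → E) ∧ X = convexHull ℝ V

variable {ι : Type*} [Fintype ι]

/-- `B = (B i)` describes a Minkowski cell `∑ i, B i` of `∑ i, P i`: every `B i` is the convex hull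
of a (nonempty) subset of the vertices of `P i`, and the sum has the full dimension. -/
structure IsMinkowskiCell (P B : ι → Set E) : Prop where
  hull : ∀ i, ∃ V : Set E, V.Nonempty ∧ V ⊆ (P i).extremePoints ℝ ∧ B i = convexHull ℝ V
  full_dim : dim (∑ i, B i) = dim (∑ i, P i)

variable [TopologicalSpace E]

/-- A mixed subdivision of the Minkowski sum `∑ i, P i`, as a set of Minkowski cells
`B = (B i)`, each given with its summands. Faces include the empty face. Different members of
the subdivision are different polytopes. -/
structure IsMixedSubdivision (P : ι → Set E) (S : Set (ι → Set E)) : Prop where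
  cell : ∀ B ∈ S, IsMinkowskiCell P B
  cover : (⋃ B ∈ S, ∑ i, B i) = ∑ i, P i
  common_face : ∀ B ∈ S, ∀ B' ∈ S,
    IsExposed ℝ (∑ i, B i) ((∑ i, B i) ∩ ∑ i, B' i) ∧
      IsExposed ℝ (∑ i, B' i) ((∑ i, B i) ∩ ∑ i, B' i)
  distinct : Set.InjOn (fun B : ι → Set E => ∑ i, B i) S

/-- A fine mixed subdivision: in each cell all summands are simplices, and their dimensions add
up to the dimension of the Minkowski sum. -/
structure IsFineMixedSubdivision (P : ι → Set E) (S : Set (ι → Set E)) : Prop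
    extends IsMixedSubdivision P S where
  simplex : ∀ B ∈ S, ∀ i, IsSimplex (B i)
  sum_dim : ∀ B ∈ S, ∑ i, dim (B i) = dim (∑ i, P i)

end MixedSubdivision

/-! ### Transversal matroids -/

namespace TransversalMatroid

variable {α : Type*} [DecidableEq α] {r : ℕ}

/-- A matching, as a set of edges `(x, j)`, of the bipartite graph of the family `A`, in which
`x` and `j` are joined when `x ∈ A j`. -/
def IsMatching (A : Fin r → Finset α) (T : Finset (α × Fin r)) : Prop :=
  (∀ e ∈ T, e.1 ∈ A e.2) ∧
    Set.InjOn Prod.fst (T : Set (α × Fin r)) ∧ Set.InjOn Prod.snd (T : Set (α × Fin r))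

/-- A matching with the largest possible number of edges. -/
def IsMaximumMatching (A : Fin r → Finset α) (T : Finset (α × Fin r)) : Prop :=
  IsMatching A T ∧ ∀ T', IsMatching A T' → T'.card ≤ T.card

/-- `A` is a presentation of the matroid `M` on the ground set `α`: the bases of `M` are the sets
of elements of `α` covered by the maximum matchings. -/
def IsPresentation (M : Matroid α) (A : Fin r → Finset α) : Prop :=
  M.E = Set.univ ∧
    ∀ B : Set α, M.IsBase B ↔ ∃ T, IsMaximumMatching A T ∧ B = ↑(T.image Prod.fst)

/-- The type of an element `x`: the set of all `j` with `x ∈ A j`. -/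
def type (A : Fin r → Finset α) (x : α) : Finset (Fin r) :=
  Finset.univ.filter fun j => x ∈ A j

/-- The number `l_I` of elements of type `I`. -/
def mult [Fintype α] (A : Fin r → Finset α) (I : Finset (Fin r)) : ℕ :=
  (Finset.univ.filter fun x => type A x = I).card

end TransversalMatroid

/-! ### Transversalhedra and good lattice points -/

namespace Transversalhedron

open TransversalMatroid

variable {r : ℕ}

/-- The points indexed by `{0, 1, …, r}`: the origin for `0`, and the unit vectors otherwise. -/
def vertex (j : Fin (r + 1)) : Fin r → ℝ :=
  Fin.cases 0 (fun k => Pi.single k 1) j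

/-- The simplex `Δ_J` in `ℝ^r` for `J ⊆ {0, 1, …, r}`. -/
def simplex (J : Set (Fin (r + 1))) : Set (Fin r → ℝ) :=
  convexHull ℝ (vertex '' J)

/-- The subset `{0} ∪ I` of `{0, 1, …, r}`. -/
def withZero (I : Finset (Fin r)) : Set (Fin (r + 1)) :=
  insert 0 (Fin.succ '' (I : Set (Fin r)))

/-- A point of `ℝ^r` with integer coordinates. -/
def IsLatticePoint (x : Fin r → ℝ) : Prop :=
  ∀ k, ∃ z : ℤ, x k = z

variable {α : Type*} [DecidableEq α] [Fintype α]

/-- The transversalhedron, the Minkowski sum of all `l_I Δ_{{0} ∪ I}`. -/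
def transversalhedron (A : Fin r → Finset α) : Set (Fin r → ℝ) :=
  ∑ I : Finset (Fin r), (mult A I : ℝ) • simplex (withZero I)

/-- The sets `I ⊆ {1, …, r}` that occur as the type of an element. -/
abbrev OccurringType (A : Fin r → Finset α) : Type :=
  {I : Finset (Fin r) // 0 < mult A I}

/-- The nontrivial Minkowski summands `l_I Δ_{{0} ∪ I}` of the transversalhedron. -/
def summand (A : Fin r → Finset α) (I : OccurringType A) : Set (Fin r → ℝ) :=
  (mult A I.1 : ℝ) • simplex (withZero I.1)

/-- For a cell with summands `B I`, the set `J_I ⊆ {0} ∪ I` with `B I = l_I Δ_{J_I}`. -/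
def labels (A : Fin r → Finset α) (B : OccurringType A → Set (Fin r → ℝ)) (I : OccurringType A) :
    Set (Fin (r + 1)) :=
  {j | j ∈ withZero I.1 ∧ (mult A I.1 : ℝ) • vertex j ∈ B I}

/-- The bipartite graph `G_J` with an edge between the left vertex `i` and the right vertex `j`
whenever `j ∈ J i`. -/
def graph {ι : Type*} (J : ι → Set (Fin (r + 1))) : SimpleGraph (ι ⊕ Fin (r + 1)) :=
  SimpleGraph.fromRel fun a b => ∃ i, ∃ j ∈ J i, a = Sum.inl i ∧ b = Sum.inr j

/-- `t ∈ J i` is joined to the right vertex `0` by a path of `G_J` that does not pass through `i`.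
When `G_J` is a spanning tree, there is exactly one such `t` for each `i`, the element `t_{i,0}`. -/
def IsRoot {ι : Type*} (J : ι → Set (Fin (r + 1))) (i : ι) (t : Fin (r + 1)) : Prop :=
  t ∈ J i ∧ ∃ w : (graph J).Walk (Sum.inr t) (Sum.inr 0), w.IsPath ∧ Sum.inl i ∉ w.support

/-- `q` is a good lattice point of `c Δ_{J i}`: it avoids the faces `c Δ_{J i \ {j}}` for all
`j ∈ J i` except `0` (if `0 ∈ J i`), or except `t_{i,0}` (if `0 ∉ J i`). -/
def IsGoodSummandPoint {ι : Type*} (J : ι → Set (Fin (r + 1))) (i : ι) (c : ℝ)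
    (q : Fin r → ℝ) : Prop :=
  IsLatticePoint q ∧ q ∈ c • simplex (J i) ∧
    (0 ∈ J i → ∀ j ∈ J i, j ≠ 0 → q ∉ c • simplex (J i \ {j})) ∧
    (0 ∉ J i → ∀ j ∈ J i, ¬ IsRoot J i j → q ∉ c • simplex (J i \ {j}))

/-- `p` is a good lattice point of the cell with summands `B I = l_I Δ_{J_I}`: it is the sum of
good lattice points of the summands. -/
def IsGoodPoint (A : Fin r → Finset α) (B : OccurringType A → Set (Fin r → ℝ))
    (p : Fin r → ℝ) : Prop :=
  ∃ q : OccurringType A → Fin r → ℝ, p = ∑ I, q I ∧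
    ∀ I, IsGoodSummandPoint (labels A B) I (mult A I.1 : ℝ) (q I)

end Transversalhedron

/-! Let `ε = 1/(r+1)` and `y = p - ε(1, …, 1)`. A cell of the subdivision contains `y` exactly when
`p` is good for it, and then `y` is even interior to the cell; so `y` selects exactly one cell.

The coordinates of `p` are integers and at least 1, and the transversalhedron is closed under
decreasing nonnegative coordinates, so `y` lies in it and hence in some cell. In a cell,
connectedness of the graph and the count of its edges give each point a unique coordinate matrix
supported on the edges, integral at lattice points (`exists_isCoord`, `coordUnique_of_card`).
Translation by `-(1, …, 1)` changes this matrix by an integral `b`: one unit flows from each `k` to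
the right vertex `0`. It satisfies `|b| ≤ r`, and is negative exactly at the edges `(i, j)` with `j`
not the root of `i` (`CoordUnique.exists_drift`). So adding `ε b` to an integral matrix keeps it
nonnegative iff its entries are at least 1 at non-root edges and at least 0 at root edges, which is
goodness (`coord_pos_of_good`, `exists_good_of_mem`). Two cells with `y` interior to both coincide,
because their intersection is a face of each (`isExposed_eq_of_coord_pos`). -/

namespace Transversalhedron

open TransversalMatroid MixedSubdivision

variable {r : ℕ}

/-! ### Barycentric coordinates on scaled simplices and their sums -/

@[simp] lemma vertex_zero : (vertex 0 : Fin r → ℝ) = 0 := rfl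

@[simp] lemma vertex_succ (k : Fin r) : vertex k.succ = Pi.single k (1 : ℝ) := rfl

lemma sum_smul_vertex_apply (a : Fin (r + 1) → ℝ) (k : Fin r) :
    (∑ j, a j • (vertex j : Fin r → ℝ)) k = a k.succ := by
  simp [Fin.sum_univ_succ, Finset.sum_apply, Pi.single_apply]

lemma mem_simplex {J : Set (Fin (r + 1))} {x : Fin r → ℝ} :
    x ∈ simplex J ↔ ∃ a : Fin (r + 1) → ℝ, (∀ j, 0 ≤ a j) ∧ (∀ j, j ∉ J → a j = 0) ∧
      ∑ j, a j = 1 ∧ ∀ k, x k = a k.succ := by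
  classical
  constructor
  · intro hx
    refine convexHull_min (t := {x | ∃ a : Fin (r + 1) → ℝ, (∀ j, 0 ≤ a j) ∧
      (∀ j, j ∉ J → a j = 0) ∧ ∑ j, a j = 1 ∧ ∀ k, x k = a k.succ}) ?_ ?_ hx
    · rintro _ ⟨j, hj, rfl⟩
      refine ⟨Pi.single j 1, fun i => ?_, fun i hi => ?_, by simp, fun k => ?_⟩
      · by_cases h : i = j
        · subst h; simp
        · simp [h]
      · have : i ≠ j := fun h => hi (h ▸ hj)
        simp [this]
      · have h : ∑ i, (Pi.single j (1 : ℝ) : Fin (r + 1) → ℝ) i • (vertex i : Fin r → ℝ) =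
            vertex j := by
          simp [Pi.single_apply]
        rw [← sum_smul_vertex_apply (Pi.single j 1), h]
    · rintro x ⟨a, ha, haJ, has, hax⟩ y ⟨b, hb, hbJ, hbs, hby⟩ s t hs ht hst
      refine ⟨fun j => s * a j + t * b j, fun j => ?_, fun j hj => ?_, ?_, fun k => ?_⟩
      · have := ha j; have := hb j; positivity
      · simp [haJ j hj, hbJ j hj]
      · rw [Finset.sum_add_distrib, ← Finset.mul_sum, ← Finset.mul_sum, has, hbs]; simpa
      · simp [hax, hby]
  · rintro ⟨a, ha, haJ, has, hax⟩
    have hx : x = ∑ j ∈ Finset.univ.filter (· ∈ J), a j • vertex j := by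
      rw [Finset.sum_filter_of_ne]
      · funext k; rw [sum_smul_vertex_apply, hax]
      · intro j _ hj
        by_contra h
        exact hj (by simp [haJ j h])
    rw [hx]
    refine (convex_convexHull ℝ _).sum_mem (fun j _ => ha j) ?_ fun j hj => ?_
    · rw [Finset.sum_filter_of_ne, has]
      intro j _ hj
      by_contra h
      exact hj (haJ j h)
    · exact subset_convexHull ℝ _ ⟨j, by simpa using hj, rfl⟩

lemma mem_smul_simplex {J : Set (Fin (r + 1))} {c : ℝ} (hc : 0 < c) {x : Fin r → ℝ} :
    x ∈ c • simplex J ↔ ∃ a : Fin (r + 1) → ℝ, (∀ j, 0 ≤ a j) ∧ (∀ j, j ∉ J → a j = 0) ∧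
      ∑ j, a j = c ∧ ∀ k, x k = a k.succ := by
  constructor
  · rintro ⟨y, hy, rfl⟩
    obtain ⟨a, ha, haJ, has, hay⟩ := mem_simplex.1 hy
    refine ⟨fun j => c * a j, fun j => ?_, fun j hj => ?_, ?_, fun k => ?_⟩
    · have := ha j; positivity
    · simp [haJ j hj]
    · rw [← Finset.mul_sum, has, mul_one]
    · simp [hay]
  · rintro ⟨a, ha, haJ, has, hax⟩
    refine ⟨c⁻¹ • x, mem_simplex.2 ⟨fun j => c⁻¹ * a j, fun j => ?_, fun j hj => ?_, ?_,
      fun k => ?_⟩, ?_⟩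
    · have := ha j; positivity
    · simp [haJ j hj]
    · rw [← Finset.mul_sum, has, inv_mul_cancel₀ hc.ne']
    · simp [hax]
    · simp [smul_smul, hc.ne']

/-- `a` is a family of barycentric coordinates, row `i` supported on `J i` with sum `c i`, whose
total is the point `x`. -/
structure IsCoord {ι K : Type*} [Fintype ι] [AddCommMonoid K]
    (J : ι → Set (Fin (r + 1))) (c : ι → K) (a : ι → Fin (r + 1) → K) (x : Fin r → K) : Prop where
  supp : ∀ i j, j ∉ J i → a i j = 0
  row : ∀ i, ∑ j, a i j = c i
  col : ∀ k, ∑ i, a i (Fin.succ k) = x k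

variable {ι : Type*} [Fintype ι]

lemma mem_sum_smul_simplex {J : ι → Set (Fin (r + 1))} {c : ι → ℝ} (hc : ∀ i, 0 < c i)
    {x : Fin r → ℝ} :
    x ∈ ∑ i, c i • simplex (J i) ↔ ∃ a : ι → Fin (r + 1) → ℝ, IsCoord J c a x ∧ ∀ i j, 0 ≤ a i j := by
  rw [Set.mem_finsetSum]
  constructor
  · rintro ⟨g, hg, rfl⟩
    choose a ha haJ has hax using fun i => (mem_smul_simplex (hc i)).1 (hg (Finset.mem_univ i))
    exact ⟨a, ⟨haJ, has, fun k => by simp [Finset.sum_apply, hax]⟩, ha⟩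
  · rintro ⟨a, ⟨haJ, has, hax⟩, ha⟩
    refine ⟨fun i k => a i k.succ, fun {i} _ => (mem_smul_simplex (hc i)).2
      ⟨a i, ha i, haJ i, has i, fun _ => rfl⟩, ?_⟩
    funext k; simp [Finset.sum_apply, hax]

lemma affineIndependent_vertex : AffineIndependent ℝ (vertex : Fin (r + 1) → Fin r → ℝ) := by
  rw [affineIndependent_iff]
  intro s w hw hs j hj
  classical
  have key : ∀ k : Fin r, (if k.succ ∈ s then w k.succ else 0) = 0 := by
    intro k
    rw [← sum_smul_vertex_apply (fun j => if j ∈ s then w j else 0) k]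
    have : ∑ j, (if j ∈ s then w j else 0) • (vertex j : Fin r → ℝ) = ∑ j ∈ s, w j • vertex j := by
      simp
    rw [this, hs]; rfl
  have hsucc : ∀ k : Fin r, k.succ ∈ s → w k.succ = 0 := fun k hk => by simpa [hk] using key k
  refine Fin.cases (fun h0 => ?_) (fun k hk => hsucc k hk) j hj
  rw [← hw]
  symm
  refine Finset.sum_eq_single_of_mem _ h0 fun b hb hb0 => ?_
  obtain ⟨k, rfl⟩ := Fin.exists_succ_eq.2 hb0
  exact hsucc k hb

lemma smul_simplex_eq (c : ℝ) (J : Set (Fin (r + 1))) :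
    c • simplex J = convexHull ℝ ((fun j => c • vertex j) '' J) := by
  rw [simplex, ← convexHull_smul, ← Set.image_smul, Set.image_image]

lemma dim_smul_simplex {c : ℝ} (hc : 0 < c) {J : Set (Fin (r + 1))} (hJ : J.Nonempty) :
    dim (c • simplex J) + 1 = J.ncard := by
  classical
  have hai : AffineIndependent ℝ (fun j : J => c • (vertex j : Fin r → ℝ)) := by
    have h := affineIndependent_vertex.comp_embedding (Function.Embedding.subtype (· ∈ J))
    have := h.map' (AffineEquiv.homothetyUnitsMulHom (0 : Fin r → ℝ)
      (Units.mk0 c hc.ne') : (Fin r → ℝ) →ᵃ[ℝ] (Fin r → ℝ)) (AffineEquiv.injective _)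
    convert this using 1
    funext j
    simp [AffineMap.homothety_apply]
  have : Nonempty J := hJ.to_subtype
  have hcard : Fintype.card J = (Fintype.card J - 1) + 1 := by
    have := Fintype.card_pos (α := J); omega
  have h := hai.finrank_vectorSpan hcard
  rw [dim, smul_simplex_eq, ← direction_affineSpan, affineSpan_convexHull, direction_affineSpan,
    show (fun j => c • vertex j) '' J = Set.range (fun j : J => c • (vertex j : Fin r → ℝ)) by
      ext; simp, h, ← hcard, ← Nat.card_eq_fintype_card, Set.ncard_def, Set.encard, ENat.card]
  simp [Nat.card_eq_fintype_card]

/-! ### Minkowski cells as sums of labelled simplices -/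

variable {α : Type*} [DecidableEq α] [Fintype α]

lemma mult_pos (A : Fin r → Finset α) (I : OccurringType A) : (0 : ℝ) < mult A I.1 := by
  exact_mod_cast I.2

/-- Extreme points of a convex hull lie among its generators, so the vertices spanning `B I` are
scaled points `vertex j`, and the labels recover them. -/
lemma eq_smul_simplex_labels {A : Fin r → Finset α} {B : OccurringType A → Set (Fin r → ℝ)}
    (hB : IsMinkowskiCell (summand A) B) (I : OccurringType A) :
    (labels A B I).Nonempty ∧ B I = (mult A I.1 : ℝ) • simplex (labels A B I) := by
  obtain ⟨V, hne, hV, hBV⟩ := hB.hull I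
  have hVsub : V ⊆ (fun j => (mult A I.1 : ℝ) • vertex j) '' labels A B I := by
    intro v hv
    have h1 := hV hv
    rw [summand, smul_simplex_eq] at h1
    obtain ⟨j, hj, rfl⟩ := extremePoints_convexHull_subset h1
    exact ⟨j, ⟨hj, hBV ▸ subset_convexHull ℝ V hv⟩, rfl⟩
  refine ⟨?_, ?_⟩
  · obtain ⟨v, hv⟩ := hne
    obtain ⟨j, hj, -⟩ := hVsub hv
    exact ⟨j, hj⟩
  · rw [smul_simplex_eq]
    apply subset_antisymm
    · rw [hBV]
      exact convexHull_mono hVsub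
    · refine convexHull_min ?_ (hBV ▸ convex_convexHull ℝ V)
      rintro _ ⟨j, hj, rfl⟩
      exact hj.2

lemma zero_mem_simplex_withZero (I : Finset (Fin r)) : (0 : Fin r → ℝ) ∈ simplex (withZero I) :=
  subset_convexHull ℝ _ ⟨0, by simp [withZero], rfl⟩

lemma transversalhedron_eq_sum_summand (A : Fin r → Finset α) :
    transversalhedron A = ∑ I, summand A I := by
  classical
  have h0 : ∀ I : Finset (Fin r), ¬ 0 < mult A I →
      (mult A I : ℝ) • simplex (withZero I) = (0 : Set (Fin r → ℝ)) := by
    intro I hI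
    have : mult A I = 0 := by omega
    rw [this, Nat.cast_zero, Set.zero_smul_set ⟨0, zero_mem_simplex_withZero I⟩]
  rw [transversalhedron, ← Finset.sum_filter_add_sum_filter_not Finset.univ (fun I => 0 < mult A I),
    Finset.sum_eq_zero (s := Finset.univ.filter fun I => ¬ 0 < mult A I), add_zero]
  · exact Finset.sum_subtype _ (by simp) _
  · intro I hI
    exact h0 I (by simpa using hI)

end Transversalhedron

namespace Transversalhedron

open TransversalMatroid MixedSubdivision

variable {r : ℕ}

/-! ### Integer flows along walks in the bipartite graph -/

section Flow

variable {ι : Type*} {J : ι → Set (Fin (r + 1))}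

lemma graph_adj_inl_inr {i : ι} {j : Fin (r + 1)} :
    (graph J).Adj (Sum.inl i) (Sum.inr j) ↔ j ∈ J i := by
  simp [graph]

lemma graph_adj_inr_inl {i : ι} {j : Fin (r + 1)} :
    (graph J).Adj (Sum.inr j) (Sum.inl i) ↔ j ∈ J i := by
  rw [SimpleGraph.adj_comm, graph_adj_inl_inr]

lemma not_graph_adj_inl_inl {i i' : ι} : ¬ (graph J).Adj (Sum.inl i) (Sum.inl i') := by
  simp [graph]

lemma not_graph_adj_inr_inr {j j' : Fin (r + 1)} :
    ¬ (graph J).Adj (Sum.inr j) (Sum.inr j') := by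
  simp [graph]

lemma isRoot_zero {i : ι} (h : 0 ∈ J i) : IsRoot J i 0 :=
  ⟨h, SimpleGraph.Walk.nil, SimpleGraph.Walk.IsPath.nil, by simp⟩

lemma exists_isRoot {i : ι} (h : (graph J).Reachable (Sum.inl i) (Sum.inr 0)) :
    ∃ t, IsRoot J i t := by
  obtain ⟨w, hw⟩ := h.exists_isPath
  cases w with
  | @cons _ v _ hadj w =>
    rw [SimpleGraph.Walk.cons_isPath_iff] at hw
    rcases v with i' | t
    · exact absurd hadj not_graph_adj_inl_inl
    · exact ⟨t, graph_adj_inl_inr.1 hadj, w, hw⟩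

variable [DecidableEq ι]

/-- The flow of a unit step: positive on an edge traversed from left to right, negative on an edge
traversed from right to left. -/
def stepFlow : ι ⊕ Fin (r + 1) → ι ⊕ Fin (r + 1) → ι → Fin (r + 1) → ℤ
  | Sum.inl i, Sum.inr j, i', j' => if i' = i ∧ j' = j then 1 else 0
  | Sum.inr j, Sum.inl i, i', j' => if i' = i ∧ j' = j then -1 else 0
  | _, _, _, _ => 0

/-- The flow of a walk: for each edge, the number of traversals from left to right minus the number
of traversals from right to left. -/
def flow {u v : ι ⊕ Fin (r + 1)} : (graph J).Walk u v → ι → Fin (r + 1) → ℤ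
  | .nil => fun _ _ => 0
  | .cons (u := u) (v := v) _ w => fun i j => stepFlow u v i j + flow w i j

lemma flow_supp {u v : ι ⊕ Fin (r + 1)} (w : (graph J).Walk u v) {i : ι} {j : Fin (r + 1)}
    (h : j ∉ J i) : flow w i j = 0 := by
  induction w with
  | nil => rfl
  | @cons u v _ hadj w ih =>
    simp only [flow, ih, add_zero]
    rcases u with a | a <;> rcases v with b | b
    · rfl
    · simp only [stepFlow, ite_eq_right_iff]
      rintro ⟨rfl, rfl⟩
      exact absurd (graph_adj_inl_inr.1 hadj) h
    · simp only [stepFlow, ite_eq_right_iff]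
      rintro ⟨rfl, rfl⟩
      exact absurd (graph_adj_inr_inl.1 hadj) h
    · rfl

/-- Telescoping: at a left vertex the row sum is net outflow, at a right vertex the column sum is
net inflow. A walk from right vertex `k` to `0` thus keeps all row sums and lowers column `k` by 1.
-/
lemma flow_row {u v : ι ⊕ Fin (r + 1)} (w : (graph J).Walk u v) (i : ι) :
    ∑ j, flow w i j = (if u = Sum.inl i then 1 else 0) - (if v = Sum.inl i then 1 else 0) := by
  induction w with
  | nil => simp [flow]
  | @cons u v _ hadj w ih =>
    simp only [flow, Finset.sum_add_distrib, ih]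
    rcases u with a | a <;> rcases v with b | b
    · exact absurd hadj not_graph_adj_inl_inl
    · by_cases h : i = a <;> simp [stepFlow, h, eq_comm]
      ring
    · by_cases h : i = b <;> simp [stepFlow, h, eq_comm]
      ring
    · exact absurd hadj not_graph_adj_inr_inr

lemma flow_col [Fintype ι] {u v : ι ⊕ Fin (r + 1)} (w : (graph J).Walk u v) (j : Fin (r + 1)) :
    ∑ i, flow w i j = (if v = Sum.inr j then 1 else 0) - (if u = Sum.inr j then 1 else 0) := by
  induction w with
  | nil => simp [flow]
  | @cons u v _ hadj w ih =>
    simp only [flow, Finset.sum_add_distrib, ih]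
    rcases u with a | a <;> rcases v with b | b
    · exact absurd hadj not_graph_adj_inl_inl
    · by_cases h : j = b <;> simp [stepFlow, h, eq_comm]
    · by_cases h : j = a <;> simp [stepFlow, h, eq_comm]
      ring
    · exact absurd hadj not_graph_adj_inr_inr

lemma flow_eq_zero_of_left {u v : ι ⊕ Fin (r + 1)} (w : (graph J).Walk u v) {i : ι}
    (h : Sum.inl i ∉ w.support) (j : Fin (r + 1)) : flow w i j = 0 := by
  induction w with
  | nil => rfl
  | @cons u v _ hadj w ih =>
    simp only [SimpleGraph.Walk.support_cons, List.mem_cons, not_or] at h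
    have hv : Sum.inl i ≠ v := fun e => h.2 (e ▸ w.start_mem_support)
    have hu := h.1
    simp only [flow, ih h.2, add_zero]
    rcases u with a | a <;> rcases v with b | b <;> simp_all [stepFlow]

lemma flow_eq_zero_of_right {u v : ι ⊕ Fin (r + 1)} (w : (graph J).Walk u v) {j : Fin (r + 1)}
    (h : Sum.inr j ∉ w.support) (i : ι) : flow w i j = 0 := by
  induction w with
  | nil => rfl
  | @cons u v _ hadj w ih =>
    simp only [SimpleGraph.Walk.support_cons, List.mem_cons, not_or] at h
    have hv : Sum.inr j ≠ v := fun e => h.2 (e ▸ w.start_mem_support)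
    have hu := h.1
    simp only [flow, ih h.2, add_zero]
    rcases u with a | a <;> rcases v with b | b <;> simp_all [stepFlow]

/-- A path uses each edge at most once: after the step along an edge it never returns to the vertex
it left. -/
lemma abs_flow_le_one {u v : ι ⊕ Fin (r + 1)} (w : (graph J).Walk u v) (hw : w.IsPath) (i : ι)
    (j : Fin (r + 1)) : |flow w i j| ≤ 1 := by
  induction w with
  | nil => simp [flow]
  | @cons u v _ hadj w ih =>
    rw [SimpleGraph.Walk.cons_isPath_iff] at hw
    have h1 := ih hw.1
    simp only [flow]
    rcases u with a | a <;> rcases v with b | b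
    · simpa [stepFlow] using h1
    · by_cases h : i = a ∧ j = b
      · obtain ⟨rfl, rfl⟩ := h
        simp [stepFlow, flow_eq_zero_of_left w hw.2]
      · simpa [stepFlow, h] using h1
    · by_cases h : i = b ∧ j = a
      · obtain ⟨rfl, rfl⟩ := h
        simp [stepFlow, flow_eq_zero_of_right w hw.2]
      · simpa [stepFlow, h] using h1
    · simpa [stepFlow] using h1

/-- Positive flow means that the path steps from `i` to `j`; its remainder is a path from `j` to `0`
avoiding `i`. -/
lemma isRoot_of_flow_pos {u v : ι ⊕ Fin (r + 1)} (w : (graph J).Walk u v) (hv : v = Sum.inr 0)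
    (hw : w.IsPath) {i : ι} {j : Fin (r + 1)} (h : 0 < flow w i j) : IsRoot J i j := by
  induction w with
  | nil => simp [flow] at h
  | @cons u v _ hadj w ih =>
    subst hv
    rw [SimpleGraph.Walk.cons_isPath_iff] at hw
    simp only [flow] at h
    rcases u with a | a <;> rcases v with b | b
    · exact ih rfl hw.1 (by simpa [stepFlow] using h)
    · by_cases h' : i = a ∧ j = b
      · obtain ⟨rfl, rfl⟩ := h'
        exact ⟨graph_adj_inl_inr.1 hadj, w, hw⟩
      · exact ih rfl hw.1 (by simpa [stepFlow, h'] using h)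
    · refine ih rfl hw.1 ?_
      simp only [stepFlow] at h
      split_ifs at h <;> omega
    · exact ih rfl hw.1 (by simpa [stepFlow] using h)

end Flow

/-! ### Existence and uniqueness of coordinates, and the drift -/

section Coord

variable {ι : Type*} [Fintype ι] {J : ι → Set (Fin (r + 1))}

lemma IsCoord.add_mul {K : Type*} [CommRing K] {c d : ι → K} {a b : ι → Fin (r + 1) → K}
    {x y : Fin r → K} (ha : IsCoord J c a x) (hb : IsCoord J d b y) (s : K) :
    IsCoord J (fun i => c i + s * d i) (fun i j => a i j + s * b i j)
      (fun k => x k + s * y k) where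
  supp i j h := by simp [ha.supp i j h, hb.supp i j h]
  row i := by rw [Finset.sum_add_distrib, ← Finset.mul_sum, ha.row, hb.row]
  col k := by rw [Finset.sum_add_distrib, ← Finset.mul_sum, ha.col, hb.col]

lemma IsCoord.intCast {c : ι → ℤ} {a : ι → Fin (r + 1) → ℤ} {x : Fin r → ℤ}
    (ha : IsCoord J c a x) :
    IsCoord J (fun i => (c i : ℝ)) (fun i j => (a i j : ℝ)) (fun k => (x k : ℝ)) where
  supp i j h := by simp [ha.supp i j h]
  row i := by rw [← ha.row i]; push_cast; rfl
  col k := by rw [← ha.col k]; push_cast; rfl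

/-- Put all of `c i` on one chosen vertex `g i`, then send the excess `z k` of each column along a
walk to `0`. Only ring operations occur, so integral data have integral coordinates. -/
lemma exists_isCoord {K : Type*} [CommRing K] (hne : ∀ i, (J i).Nonempty)
    (hconn : ∀ j, (graph J).Reachable (Sum.inr j) (Sum.inr 0)) (c : ι → K) (x : Fin r → K) :
    ∃ a, IsCoord J c a x := by
  classical
  choose g hg using hne
  have w : ∀ j, (graph J).Walk (Sum.inr j) (Sum.inr 0) := fun j => (hconn j).some
  set z : Fin r → K := fun k => (∑ i, if k.succ = g i then c i else 0) - x k with hz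
  refine ⟨fun i j => (if j = g i then c i else 0) + ∑ k, z k * (flow (w k.succ) i j : K),
    fun i j h => ?_, fun i => ?_, fun k => ?_⟩
  · have : j ≠ g i := fun e => h (e ▸ hg i)
    simp [this, flow_supp _ h]
  · rw [Finset.sum_add_distrib, Finset.sum_comm]
    have : ∀ k, ∑ j, z k * (flow (w (Fin.succ k)) i j : K) = 0 := by
      intro k
      rw [← Finset.mul_sum, ← Int.cast_sum, flow_row]
      simp
    simp [this]
  · rw [Finset.sum_add_distrib, Finset.sum_comm]
    have : ∀ k', ∑ i, z k' * (flow (w (Fin.succ k')) i k.succ : K) =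
        if k' = k then - z k else 0 := by
      intro k'
      rw [← Finset.mul_sum, ← Int.cast_sum, flow_col]
      by_cases h : k' = k
      · subst h; simp [(Fin.succ_ne_zero k').symm]
      · simp [h, (Fin.succ_ne_zero k).symm]
    rw [Finset.sum_congr rfl fun k' _ => this k']
    simp [hz]

/-- The coordinates of a point are unique. -/
def CoordUnique (J : ι → Set (Fin (r + 1))) : Prop :=
  ∀ a : ι → Fin (r + 1) → ℝ, IsCoord J 0 a 0 → a = 0

lemma CoordUnique.eq (hU : CoordUnique J) {c : ι → ℝ} {a b : ι → Fin (r + 1) → ℝ} {x : Fin r → ℝ}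
    (ha : IsCoord J c a x) (hb : IsCoord J c b x) : a = b := by
  have h := hU _ (by simpa [← Pi.zero_def] using ha.add_mul hb (-1))
  funext i j
  have := congr_fun (congr_fun h i) j
  simp at this
  linarith

/-- Connectedness makes the map from edge weights to row sums and columns `1, …, r` surjective; the
edge count equates the dimensions, so it is injective. -/
lemma coordUnique_of_card (hne : ∀ i, (J i).Nonempty)
    (hconn : ∀ j, (graph J).Reachable (Sum.inr j) (Sum.inr 0))
    (hcard : ∑ i, (J i).ncard = Fintype.card ι + r) : CoordUnique J := by
  classical
  let e : ((Σ i, J i) → ℝ) →ₗ[ℝ] (ι → Fin (r + 1) → ℝ) :=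
    { toFun := fun a i j => if h : j ∈ J i then a ⟨i, j, h⟩ else 0
      map_add' := fun a b => by
        funext i j
        by_cases h : j ∈ J i <;> simp [h]
      map_smul' := fun s a => by
        funext i j
        by_cases h : j ∈ J i <;> simp [h] }
  let b : (ι → Fin (r + 1) → ℝ) →ₗ[ℝ] (ι → ℝ) × (Fin r → ℝ) :=
    { toFun := fun a => (fun i => ∑ j, a i j, fun k => ∑ i, a i (Fin.succ k))
      map_add' := fun a b => by
        ext <;> simp [Finset.sum_add_distrib]
      map_smul' := fun s a => by
        ext <;> simp [Finset.mul_sum] }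
  have he : ∀ a : ι → Fin (r + 1) → ℝ, (∀ i j, j ∉ J i → a i j = 0) →
      e (fun s => a s.1 s.2) = a := by
    intro a ha
    funext i j
    by_cases h : j ∈ J i
    · simp [e, h]
    · simp [e, h, ha i j h]
  have hsurj : Function.Surjective (b ∘ₗ e) := by
    rintro ⟨c, x⟩
    obtain ⟨a, ha⟩ := exists_isCoord hne hconn c x
    refine ⟨fun s => a s.1 s.2, ?_⟩
    rw [LinearMap.comp_apply, he a ha.supp]
    exact Prod.ext (funext ha.row) (funext ha.col)
  have hdim : Module.finrank ℝ ((Σ i, J i) → ℝ) = Module.finrank ℝ ((ι → ℝ) × (Fin r → ℝ)) := by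
    simp only [Module.finrank_prod, Module.finrank_fintype_fun_eq_card, Fintype.card_fin,
      Fintype.card_sigma]
    rw [← hcard]
    exact Finset.sum_congr rfl fun i _ => by
      rw [← Nat.card_eq_fintype_card, Nat.card_coe_set_eq]
  have hinj := (LinearMap.injective_iff_surjective_of_finrank_eq_finrank hdim).2 hsurj
  intro a ha
  have h0 : (fun s : Σ i, J i => a s.1 s.2) = 0 := by
    apply hinj
    rw [LinearMap.comp_apply, he a ha.supp, map_zero]
    exact Prod.ext (funext ha.row) (funext ha.col)
  rw [← he a ha.supp, h0, map_zero]

/-- On the components missing `0`, the column total equals the row total. The sum of the unreachable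
coordinates is therefore constant on the Minkowski sum, impossible in full dimension unless there
are none. -/
lemma reachable_of_vectorSpan_eq_top {c : ι → ℝ} (hc : ∀ i, 0 < c i)
    (hspan : vectorSpan ℝ (∑ i, c i • simplex (J i)) = ⊤) (j : Fin (r + 1)) :
    (graph J).Reachable (Sum.inr j) (Sum.inr 0) := by
  classical
  let h : (Fin r → ℝ) →ₗ[ℝ] ℝ :=
    { toFun := fun x => ∑ k : Fin r,
        if (graph J).Reachable (Sum.inr k.succ) (Sum.inr 0) then 0 else x k
      map_add' := fun x y => by
        rw [← Finset.sum_add_distrib]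
        exact Finset.sum_congr rfl fun k _ => by split_ifs <;> simp
      map_smul' := fun s x => by
        rw [RingHom.id_apply, smul_eq_mul, Finset.mul_sum]
        exact Finset.sum_congr rfl fun k _ => by split_ifs <;> simp }
  have hconst : ∀ x ∈ ∑ i, c i • simplex (J i),
      h x = ∑ i, if (graph J).Reachable (Sum.inl i) (Sum.inr 0) then 0 else c i := by
    intro x hx
    obtain ⟨a, ha, -⟩ := (mem_sum_smul_simplex hc).1 hx
    have h1 : h x = ∑ j : Fin (r + 1), if (graph J).Reachable (Sum.inr j) (Sum.inr 0) then 0 else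
        ∑ i, a i j := by
      rw [Fin.sum_univ_succ, if_pos (SimpleGraph.Reachable.refl _), zero_add]
      simp only [ha.col]
      rfl
    have h2 : ∀ j, (if (graph J).Reachable (Sum.inr j) (Sum.inr 0) then 0 else ∑ i, a i j) =
        ∑ i, if (graph J).Reachable (Sum.inl i) (Sum.inr 0) then 0 else a i j := by
      intro j
      have h3 : ∀ i, (if (graph J).Reachable (Sum.inr j) (Sum.inr 0) then 0 else a i j) =
          if (graph J).Reachable (Sum.inl i) (Sum.inr 0) then 0 else a i j := by
        intro i
        by_cases hj : j ∈ J i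
        · have hadj := (graph_adj_inl_inr.2 hj).reachable
          have : (graph J).Reachable (Sum.inr j) (Sum.inr 0) ↔
              (graph J).Reachable (Sum.inl i) (Sum.inr 0) :=
            ⟨fun h => hadj.trans h, fun h => hadj.symm.trans h⟩
          simp only [this]
        · simp [ha.supp i j hj]
      rw [← Finset.sum_congr rfl fun i _ => h3 i]
      split_ifs <;> simp
    rw [h1, Finset.sum_congr rfl fun j _ => h2 j, Finset.sum_comm]
    refine Finset.sum_congr rfl fun i _ => ?_
    split_ifs
    · simp
    · exact ha.row i
  have hle : vectorSpan ℝ (∑ i, c i • simplex (J i)) ≤ LinearMap.ker h := by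
    rw [vectorSpan_def, Submodule.span_le]
    rintro _ ⟨x, hx, y, hy, rfl⟩
    simp [hconst x hx, hconst y hy]
  rw [hspan] at hle
  refine Fin.cases (SimpleGraph.Reachable.refl _) (fun k => ?_) j
  by_contra hk
  have := hle (Submodule.mem_top (x := Pi.single k (1 : ℝ)))
  simp only [LinearMap.mem_ker, LinearMap.coe_mk, AddHom.coe_mk, h] at this
  rw [Finset.sum_eq_single k] at this
  · simp [hk] at this
  · intro b _ hb; simp [hb]
  · simp

lemma isCoord_flow_sub [DecidableEq ι] {u : ι ⊕ Fin (r + 1)}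
    (w w' : (graph J).Walk u (Sum.inr 0)) :
    IsCoord J 0 (fun i j => ((flow w i j - flow w' i j : ℤ) : ℝ)) 0 where
  supp i j h := by simp [flow_supp _ h]
  row i := by rw [← Int.cast_sum, Finset.sum_sub_distrib, flow_row, flow_row]; simp
  col k := by rw [← Int.cast_sum, Finset.sum_sub_distrib, flow_col, flow_col]; simp

lemma CoordUnique.flow_eq [DecidableEq ι] (hU : CoordUnique J) {u : ι ⊕ Fin (r + 1)}
    (w w' : (graph J).Walk u (Sum.inr 0)) : flow w = flow w' := by
  have h := hU _ (isCoord_flow_sub w w')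
  funext i j
  have := congr_fun (congr_fun h i) j
  simp only [Pi.zero_apply, Int.cast_eq_zero] at this
  omega

lemma CoordUnique.isRoot_eq (hU : CoordUnique J) {i : ι} {t t' : Fin (r + 1)} (h : IsRoot J i t)
    (h' : IsRoot J i t') : t = t' := by
  classical
  obtain ⟨ht, w, -, hw⟩ := h
  obtain ⟨ht', w', -, hw'⟩ := h'
  -- Two walks from `i` to `0` have equal flow, yet on the edge `(i, t)` only the first has flow 1
  -- if `t ≠ t'`.
  have := hU.flow_eq (.cons (graph_adj_inl_inr.2 ht) w) (.cons (graph_adj_inl_inr.2 ht') w')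
  have := congr_fun (congr_fun this i) t
  by_contra hne
  simp [flow, stepFlow, flow_eq_zero_of_left _ hw, flow_eq_zero_of_left _ hw', hne] at this

/-- Moving a point in the direction `-(1, …, 1)` decreases all its coordinates, except that the
root coordinates do not decrease. -/
lemma CoordUnique.exists_drift (hU : CoordUnique J)
    (hconn : ∀ v, (graph J).Reachable v (Sum.inr 0)) :
    ∃ b : ι → Fin (r + 1) → ℤ, IsCoord J 0 b (fun _ => -1) ∧ (∀ i j, |b i j| ≤ r) ∧
      ∀ i j, j ∈ J i → ¬ IsRoot J i j → b i j < 0 := by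
  classical
  choose w hw using fun j => (hconn (Sum.inr j)).exists_isPath
  have hle : ∀ k i j, ¬ IsRoot J i j → flow (w k) i j ≤ 0 := fun k i j hj => by
    by_contra h
    exact hj (isRoot_of_flow_pos (w k) rfl (hw k) (by omega))
  refine ⟨fun i j => ∑ k : Fin r, flow (w k.succ) i j, ⟨fun i j h => ?_, fun i => ?_, fun k => ?_⟩,
    fun i j => ?_, fun i j hj hroot => ?_⟩
  · simp [flow_supp _ h]
  · rw [Finset.sum_comm]
    simp [flow_row]
  · rw [Finset.sum_comm]
    simp [flow_col, (Fin.succ_ne_zero k).symm]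
  · refine (Finset.abs_sum_le_sum_abs _ _).trans ?_
    refine (Finset.sum_le_sum fun k _ => abs_flow_le_one _ (hw _) i j).trans ?_
    simp
  · have hj0 : j ≠ 0 := fun e => hroot (e ▸ isRoot_zero (e ▸ hj))
    obtain ⟨k, rfl⟩ := Fin.exists_succ_eq.2 hj0
    refine Finset.sum_neg' (fun k' _ => hle _ i _ hroot) ⟨k, Finset.mem_univ _, ?_⟩
    obtain ⟨t, ht⟩ := exists_isRoot (hconn (Sum.inl i))
    have hne : k.succ ≠ t := fun e => hroot (e ▸ ht)
    obtain ⟨htJ, w', -, hw'⟩ := ht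
    -- The flow may be computed on any walk: going from `k.succ` through `i` to its root `t` crosses
    -- the edge `(i, k.succ)` backwards.
    rw [hU.flow_eq (w k.succ)
      (.cons (graph_adj_inr_inl.2 hj) (.cons (graph_adj_inl_inr.2 htJ) w'))]
    simp [flow, stepFlow, flow_eq_zero_of_left _ hw', hne]

end Coord

end Transversalhedron

namespace Transversalhedron

open TransversalMatroid MixedSubdivision

variable {r : ℕ}

/-! ### Goodness in one cell versus membership of the shifted point -/

section Cell

variable {ι : Type*} [Fintype ι] {J : ι → Set (Fin (r + 1))}

/-- Scale column `k` by `y k / x k` and give the surplus of each row to the vertex `0`. If `x k =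
0`, then `y k = 0` and the ratio is 0. -/
lemma mem_sum_smul_simplex_of_le {c : ι → ℝ} (hc : ∀ i, 0 < c i) (h0 : ∀ i, 0 ∈ J i)
    {x y : Fin r → ℝ} (hx : x ∈ ∑ i, c i • simplex (J i)) (hy0 : ∀ k, 0 ≤ y k)
    (hyx : ∀ k, y k ≤ x k) : y ∈ ∑ i, c i • simplex (J i) := by
  obtain ⟨a, ha, hpos⟩ := (mem_sum_smul_simplex hc).1 hx
  have hx0 : ∀ k, 0 ≤ x k := fun k => (hy0 k).trans (hyx k)
  have hle : ∀ i k, a i (Fin.succ k) * (y k / x k) ≤ a i k.succ := fun i k =>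
    mul_le_of_le_one_right (hpos _ _) (div_le_one_of_le₀ (hyx k) (hx0 k))
  refine (mem_sum_smul_simplex hc).2 ⟨fun i => Fin.cons
    (c i - ∑ k, a i (Fin.succ k) * (y k / x k)) fun k => a i k.succ * (y k / x k),
    ⟨fun i j hj => ?_, fun i => ?_, fun k => ?_⟩, fun i j => ?_⟩
  · have hj0 : j ≠ 0 := fun e => hj (e ▸ h0 i)
    obtain ⟨k, rfl⟩ := Fin.exists_succ_eq.2 hj0
    simp [ha.supp i _ hj]
  · simp [Fin.sum_univ_succ]
  · simp only [Fin.cons_succ]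
    rw [← Finset.sum_mul, ha.col]
    rcases (hx0 k).eq_or_lt with h | h
    · have h1 := hyx k
      rw [← h] at h1 ⊢
      simp [le_antisymm h1 (hy0 k)]
    · field_simp
  · refine Fin.cases ?_ (fun k => ?_) j
    · have h1 := ha.row i
      rw [Fin.sum_univ_succ] at h1
      have h2 := Finset.sum_le_sum fun k (_ : k ∈ Finset.univ) => hle i k
      have h3 := hpos i 0
      simp only [Fin.cons_zero]
      linarith
    · simp only [Fin.cons_succ]
      exact mul_nonneg (hpos _ _) (div_nonneg (hy0 k) (hx0 k))

lemma vectorSpan_sum_smul_simplex_eq_top {c : ι → ℝ} (hc : ∀ i, 0 < c i) (h0 : ∀ i, 0 ∈ J i)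
    (hJ : ∀ k : Fin r, ∃ i, k.succ ∈ J i) : vectorSpan ℝ (∑ i, c i • simplex (J i)) = ⊤ := by
  classical
  have hzero : (0 : Fin r → ℝ) ∈ ∑ i, c i • simplex (J i) :=
    (Set.mem_finsetSum _ _ _).2 ⟨fun _ => 0, fun {i} _ =>
      ⟨0, subset_convexHull ℝ _ ⟨0, h0 i, rfl⟩, smul_zero _⟩, by simp⟩
  have hsingle : ∀ k : Fin r, Pi.single k (1 : ℝ) ∈ vectorSpan ℝ (∑ i, c i • simplex (J i)) := by
    intro k
    obtain ⟨i, hi⟩ := hJ k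
    have hmem : c i • Pi.single k (1 : ℝ) ∈ ∑ i, c i • simplex (J i) := by
      refine (Set.mem_finsetSum _ _ _).2 ⟨fun i' => if i' = i then c i • Pi.single k (1 : ℝ) else 0,
        fun {i'} _ => ?_, by simp⟩
      by_cases h : i' = i
      · subst h
        simp only [if_true]
        exact Set.smul_mem_smul_set (subset_convexHull ℝ _ ⟨k.succ, hi, rfl⟩)
      · simp only [h, if_false]
        exact ⟨0, subset_convexHull ℝ _ ⟨0, h0 i', rfl⟩, smul_zero _⟩
    have h := vsub_mem_vectorSpan ℝ hmem hzero
    rw [vsub_eq_sub, sub_zero] at h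
    simpa [smul_smul, (hc i).ne'] using Submodule.smul_mem _ (c i)⁻¹ h
  rw [eq_top_iff]
  intro x _
  rw [pi_eq_sum_univ' x]
  refine Submodule.sum_mem _ fun k _ => Submodule.smul_mem _ _ ?_
  convert hsingle k using 1

/-- Positive coordinates allow a small move from `y` directly away from any `x` of the sum. A
functional maximal at `y` then cannot be smaller at `x`, so the face is everything. -/
lemma isExposed_eq_of_coord_pos {c : ι → ℝ} (hc : ∀ i, 0 < c i) {a : ι → Fin (r + 1) → ℝ}
    {y : Fin r → ℝ} (ha : IsCoord J c a y) (hpos : ∀ i, ∀ j ∈ J i, 0 < a i j)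
    {C : Set (Fin r → ℝ)} (hC : IsExposed ℝ (∑ i, c i • simplex (J i)) C) (hy : y ∈ C) :
    C = ∑ i, c i • simplex (J i) := by
  obtain ⟨l, rfl⟩ := hC ⟨y, hy⟩
  refine subset_antisymm (fun x hx => hx.1) fun x hx => ⟨hx, fun z hz => (hy.2 z hz).trans ?_⟩
  obtain ⟨b, hb, hb0⟩ := (mem_sum_smul_simplex hc).1 hx
  obtain ⟨δ, hδ, hδb⟩ : ∃ δ : ℝ, 0 < δ ∧ ∀ i, ∀ j ∈ J i, 0 ≤ a i j + δ * (a i j - b i j) := by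
    have h : ∀ i j, j ∈ J i → ∀ᶠ δ : ℝ in nhdsWithin 0 (Set.Ioi 0),
        0 ≤ a i j + δ * (a i j - b i j) := by
      intro i j hj
      have hcont : Filter.Tendsto (fun δ : ℝ => a i j + δ * (a i j - b i j)) (nhds 0)
          (nhds (a i j)) := by
        have : Continuous fun δ : ℝ => a i j + δ * (a i j - b i j) := by fun_prop
        simpa using this.tendsto 0
      exact ((hcont.mono_left nhdsWithin_le_nhds).eventually (lt_mem_nhds (hpos i j hj))).mono
        fun _ h => h.le
    have hall : ∀ᶠ δ : ℝ in nhdsWithin 0 (Set.Ioi 0), ∀ i j, j ∈ J i →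
        0 ≤ a i j + δ * (a i j - b i j) := by
      simp only [Filter.eventually_all]
      exact h
    obtain ⟨δ, h1, h2⟩ := (hall.and self_mem_nhdsWithin).exists
    exact ⟨δ, h2, h1⟩
  have hmem : (fun k => y k + δ * (y k + -1 * x k)) ∈ ∑ i, c i • simplex (J i) := by
    refine (mem_sum_smul_simplex hc).2 ⟨fun i j => a i j + δ * (a i j + -1 * b i j), ?_, ?_⟩
    · simpa using ha.add_mul (ha.add_mul hb (-1)) δ
    · intro i j
      by_cases hj : j ∈ J i
      · simpa [sub_eq_add_neg] using hδb i j hj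
      · simp [ha.supp i j hj, hb.supp i j hj]
  have h := hy.2 _ hmem
  have he : (fun k => y k + δ * (y k + -1 * x k)) = y + δ • (y - x) := by
    funext k; simp [sub_eq_add_neg, mul_add]
  rw [he, map_add, map_smul, map_sub, smul_eq_mul] at h
  by_contra hlt
  push Not at hlt
  have := mul_pos hδ (sub_pos.2 hlt)
  linarith

/-- The choice of `ε`: each of `r` paths changes an entry by at most 1, so the shift stays below 1.
-/
lemma abs_drift_lt {b : ℤ} (hb : |b| ≤ r) : |(1 / (r + 1 : ℝ)) * b| < 1 := by
  have h : |(b : ℝ)| ≤ r := by exact_mod_cast hb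
  rw [abs_mul, abs_of_pos (by positivity), one_div, inv_mul_lt_iff₀ (by positivity)]
  linarith

lemma coord_pos_of_good (hU : CoordUnique J) (hconn : ∀ v, (graph J).Reachable v (Sum.inr 0))
    {c : ι → ℝ} (hc : ∀ i, 0 < c i) {q : ι → Fin r → ℝ}
    (hq : ∀ i, IsGoodSummandPoint J i (c i) (q i)) :
    ∃ a, IsCoord J c a (fun k => (∑ i, q i) k + (1 / (r + 1 : ℝ)) * (-1)) ∧
      ∀ i, ∀ j ∈ J i, 0 < a i j := by
  obtain ⟨b, hb, hbr, hbneg⟩ := hU.exists_drift hconn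
  choose a ha haJ has haq using fun i => (mem_smul_simplex (hc i)).1 (hq i).2.1
  have hcoord : IsCoord J c a (∑ i, q i) :=
    ⟨haJ, has, fun k => by simp [Finset.sum_apply, haq]⟩
  have hone : ∀ i, ∀ j ∈ J i, ¬ IsRoot J i j → 1 ≤ a i j := by
    intro i j hj hroot
    have hj0 : j ≠ 0 := fun e => hroot (e ▸ isRoot_zero (e ▸ hj))
    have hface : q i ∉ c i • simplex (J i \ {j}) := by
      by_cases h0 : 0 ∈ J i
      · exact (hq i).2.2.1 h0 j hj hj0
      · exact (hq i).2.2.2 h0 j hj hroot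
    have hne : a i j ≠ 0 := by
      intro h
      refine hface ((mem_smul_simplex (hc i)).2 ⟨a i, ha i, fun j' hj' => ?_, has i, haq i⟩)
      by_cases hjj : j' = j
      · rw [hjj, h]
      · exact haJ i j' fun hmem => hj' ⟨hmem, hjj⟩
    obtain ⟨k, rfl⟩ := Fin.exists_succ_eq.2 hj0
    obtain ⟨z, hz⟩ := (hq i).1 k
    have hpos : 0 < a i k.succ := lt_of_le_of_ne (ha i _) hne.symm
    rw [← haq, hz] at hpos ⊢
    exact_mod_cast (by exact_mod_cast hpos : 0 < z)
  have hsum := hcoord.add_mul hb.intCast (1 / (r + 1 : ℝ))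
  refine ⟨fun i j => a i j + (1 / (r + 1 : ℝ)) * b i j, by simpa using hsum, fun i j hj => ?_⟩
  by_cases hroot : IsRoot J i j
  · have hnon : ∀ j' ∈ J i, j' ≠ j → ¬ IsRoot J i j' := fun j' _ hne h => hne (hU.isRoot_eq h hroot)
    have hrow := hb.row i
    rw [← Finset.add_sum_erase _ _ (Finset.mem_univ j)] at hrow
    have hle : ∀ j' ∈ Finset.univ.erase j, b i j' ≤ 0 := by
      intro j' hj'
      by_cases hmem : j' ∈ J i
      · exact (hbneg i j' hmem (hnon j' hmem (Finset.ne_of_mem_erase hj'))).le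
      · exact (hb.supp i j' hmem).le
    by_cases hex : ∃ j' ∈ J i, j' ≠ j
    · obtain ⟨j', hj', hne⟩ := hex
      have := Finset.sum_neg' hle ⟨j', by simp [hne], hbneg i j' hj' (hnon j' hj' hne)⟩
      have hbpos : 0 < b i j := by
        simp only [Pi.zero_apply] at hrow
        omega
      have : (0 : ℝ) < b i j := by exact_mod_cast hbpos
      have := ha i j
      positivity
    -- With a single vertex in `J i`, the root entry is the whole `c i > 0`.
    · push Not at hex
      have haz : a i j = c i := by
        rw [← has i]
        exact (Finset.sum_eq_single j (fun j' _ hne => haJ i j' fun h => hne (hex j' h))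
          (by simp)).symm
      have := Finset.sum_nonpos hle
      have hbpos : 0 ≤ b i j := by
        simp only [Pi.zero_apply] at hrow
        omega
      have : (0 : ℝ) ≤ b i j := by exact_mod_cast hbpos
      have := hc i
      simp only [haz]
      positivity
  · have h1 := hone i j hj hroot
    have h2 := (abs_lt.1 (abs_drift_lt (hbr i j))).1
    linarith

lemma exists_good_of_mem (hne : ∀ i, (J i).Nonempty) (hU : CoordUnique J)
    (hconn : ∀ v, (graph J).Reachable v (Sum.inr 0)) {n : ι → ℕ} (hn : ∀ i, (0 : ℝ) < n i)
    {p : Fin r → ℝ} (hp : IsLatticePoint p)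
    (hy : (fun k => p k + (1 / (r + 1 : ℝ)) * (-1)) ∈ ∑ i, (n i : ℝ) • simplex (J i)) :
    ∃ q : ι → Fin r → ℝ, p = ∑ i, q i ∧ ∀ i, IsGoodSummandPoint J i (n i) (q i) := by
  obtain ⟨b, hb, hbr, hbneg⟩ := hU.exists_drift hconn
  choose z hz using hp
  obtain ⟨a, ha⟩ := exists_isCoord hne (fun j => hconn (Sum.inr j)) (fun i => (n i : ℤ)) z
  obtain ⟨a', ha', hpos⟩ := (mem_sum_smul_simplex hn).1 hy
  -- By uniqueness, the nonnegative coordinates of the shifted point are the integral ones of `p`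
  -- plus `ε b`.
  have heq : a' = fun i j => (a i j : ℝ) + (1 / (r + 1 : ℝ)) * b i j := by
    refine hU.eq ha' ?_
    simpa [hz] using ha.intCast.add_mul hb.intCast (1 / (r + 1 : ℝ))
  have hshift : ∀ i j, 0 ≤ (a i j : ℝ) + (1 / (r + 1 : ℝ)) * b i j := fun i j => by
    simpa [heq] using hpos i j
  have hanon : ∀ i, ∀ j ∈ J i, ¬ IsRoot J i j → a i j ≠ 0 := by
    intro i j hj hroot h0
    have h1 := hshift i j
    have h2 : (b i j : ℝ) < 0 := by exact_mod_cast hbneg i j hj hroot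
    have h3 : (1 / (r + 1 : ℝ)) * b i j < 0 := mul_neg_of_pos_of_neg (by positivity) h2
    rw [h0, Int.cast_zero] at h1
    linarith
  have hapos : ∀ i j, 0 ≤ a i j := by
    intro i j
    have h1 := hshift i j
    have h2 := (abs_lt.1 (abs_drift_lt (hbr i j))).2
    have : (-1 : ℝ) < a i j := by linarith
    have : -1 < a i j := by exact_mod_cast this
    omega
  have hface : ∀ i, ∀ j ∈ J i, j ≠ 0 → ¬ IsRoot J i j →
      (fun k => (a i (Fin.succ k) : ℝ)) ∉ (n i : ℝ) • simplex (J i \ {j}) := by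
    intro i j hj hj0 hroot hmem
    obtain ⟨a'', -, hJ, -, hq⟩ := (mem_smul_simplex (hn i)).1 hmem
    obtain ⟨k, rfl⟩ := Fin.exists_succ_eq.2 hj0
    have := hq k
    rw [hJ k.succ (by simp)] at this
    exact hanon i _ hj hroot (by exact_mod_cast this)
  refine ⟨fun i k => a i k.succ, ?_, fun i => ⟨fun k => ⟨_, rfl⟩, ?_, fun h0 j hj hj0 => ?_,
    fun h0 j hj hroot => ?_⟩⟩
  · funext k
    rw [hz, ← ha.col k]
    simp [Finset.sum_apply]
  · exact (mem_smul_simplex (hn i)).2 ⟨fun j => a i j, fun j => Int.cast_nonneg (hapos i j),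
      ha.intCast.supp i, by simpa using ha.intCast.row i, fun _ => rfl⟩
  · exact hface i j hj hj0 fun h => hj0 (hU.isRoot_eq h (isRoot_zero h0))
  · exact hface i j hj (fun e => h0 (e ▸ hj)) hroot

end Cell

/-! ### Cells of a fine mixed subdivision and the main theorem -/

variable {α : Type*} [DecidableEq α] [Fintype α]

lemma cell_sum_eq {A : Fin r → Finset α} {B : OccurringType A → Set (Fin r → ℝ)}
    (hB : IsMinkowskiCell (summand A) B) :
    ∑ I, B I = ∑ I, (mult A I.1 : ℝ) • simplex (labels A B I) :=
  Finset.sum_congr rfl fun I _ => (eq_smul_simplex_labels hB I).2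

/-- The graph of a cell of a fine mixed subdivision is connected, and coordinates with respect to
the cell are unique. -/
lemma cell_connected_and_coordUnique {A : Fin r → Finset α}
    {S : Set (OccurringType A → Set (Fin r → ℝ))} (hS : IsFineMixedSubdivision (summand A) S)
    (hspan : vectorSpan ℝ (∑ I, summand A I) = ⊤) {B : OccurringType A → Set (Fin r → ℝ)}
    (hB : B ∈ S) :
    (∀ v, (graph (labels A B)).Reachable v (Sum.inr 0)) ∧ CoordUnique (labels A B) := by
  have hcell := hS.cell B hB
  have hne := fun I => (eq_smul_simplex_labels hcell I).1
  have hdim : dim (∑ I, summand A I) = r := by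
    rw [dim, hspan, finrank_top, Module.finrank_fintype_fun_eq_card, Fintype.card_fin]
  have hfull : vectorSpan ℝ (∑ I, (mult A I.1 : ℝ) • simplex (labels A B I)) = ⊤ := by
    apply Submodule.eq_top_of_finrank_eq
    have := hcell.full_dim
    rw [hdim, dim, cell_sum_eq hcell] at this
    rw [this, Module.finrank_fintype_fun_eq_card, Fintype.card_fin]
  have hconn := reachable_of_vectorSpan_eq_top (mult_pos A) hfull
  refine ⟨?_, coordUnique_of_card hne hconn ?_⟩
  · rintro (I | j)
    · obtain ⟨j, hj⟩ := hne I
      exact (graph_adj_inl_inr.2 hj).reachable.trans (hconn j)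
    · exact hconn j
  -- Fineness counts the edges: each left vertex has degree `dim (B I) + 1`, and the dimensions sum
  -- to `r`.
  · have h := hS.sum_dim B hB
    have h2 : ∀ I, (labels A B I).ncard = dim (B I) + 1 := fun I => by
      rw [(eq_smul_simplex_labels hcell I).2, dim_smul_simplex (mult_pos A I) (hne I)]
    rw [Finset.sum_congr rfl fun I _ => h2 I, Finset.sum_add_distrib, h, hdim]
    simp [add_comm]

end Transversalhedron

open Transversalhedron MixedSubdivision TransversalMatroid

theorem mainTheorem4 {α : Type*} [DecidableEq α] [Fintype α] {r : ℕ}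
    (M : Matroid α) (hr : M.eRank = r)
    (A : Fin r → Finset α) (hA : TransversalMatroid.IsPresentation M A)
    (S : Set (Transversalhedron.OccurringType A → Set (Fin r → ℝ)))
    (hS : MixedSubdivision.IsFineMixedSubdivision (Transversalhedron.summand A) S)
    (p : Fin r → ℝ) (hlat : Transversalhedron.IsLatticePoint p)
    (hp : p ∈ Transversalhedron.transversalhedron A) (hp0 : ∀ k, p k ≠ 0) :
    ∃! B, B ∈ S ∧ Transversalhedron.IsGoodPoint A B p := by
  rw [transversalhedron_eq_sum_summand] at hp
  have hzero : ∀ I : OccurringType A, (0 : Fin (r + 1)) ∈ withZero I.1 := fun I => by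
    simp [withZero]
  obtain ⟨a, ha, hapos⟩ := (mem_sum_smul_simplex (mult_pos A)).1 hp
  have hspan : vectorSpan ℝ (∑ I, summand A I) = ⊤ := by
    refine vectorSpan_sum_smul_simplex_eq_top (mult_pos A) hzero fun k => ?_
    -- If no occurring type contained `k`, the coordinate `p k` would vanish; so the
    -- transversalhedron is full-dimensional.
    by_contra! hk
    exact hp0 k (by rw [← ha.col k]; exact Finset.sum_eq_zero fun I _ => ha.supp I _ (hk I))
  have hone : ∀ k, 1 ≤ p k := by
    intro k
    have hpos : 0 < p k := lt_of_le_of_ne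
      (by rw [← ha.col k]; exact Finset.sum_nonneg fun I _ => hapos I _) (hp0 k).symm
    obtain ⟨z, hz⟩ := hlat k
    rw [hz] at hpos ⊢
    exact_mod_cast (by exact_mod_cast hpos : 0 < z)
  have hε : (1 / (r + 1 : ℝ)) ≤ 1 := by
    rw [div_le_one (by positivity)]
    linarith [(Nat.cast_nonneg r : (0 : ℝ) ≤ r)]
  have hε0 : 0 < (1 / (r + 1 : ℝ)) := by positivity
  have hy : (fun k => p k + (1 / (r + 1 : ℝ)) * (-1)) ∈ ∑ I, summand A I :=
    mem_sum_smul_simplex_of_le (mult_pos A) hzero hp (fun k => by linarith [hone k])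
      fun k => by linarith
  have hgood : ∀ B ∈ S, IsGoodPoint A B p → ∃ a, IsCoord (labels A B) (fun I => (mult A I.1 : ℝ)) a
      (fun k => p k + (1 / (r + 1 : ℝ)) * (-1)) ∧ ∀ I, ∀ j ∈ labels A B I, 0 < a I j := by
    rintro B hB ⟨q, rfl, hq⟩
    obtain ⟨hconn, hU⟩ := cell_connected_and_coordUnique hS hspan hB
    exact coord_pos_of_good hU hconn (mult_pos A) hq
  have hexists : ∃ B ∈ S, IsGoodPoint A B p := by
    rw [← hS.cover, Set.mem_iUnion₂] at hy
    obtain ⟨B, hB, hyB⟩ := hy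
    obtain ⟨hconn, hU⟩ := cell_connected_and_coordUnique hS hspan hB
    have hcell := hS.cell B hB
    rw [cell_sum_eq hcell] at hyB
    exact ⟨B, hB, exists_good_of_mem (fun I => (eq_smul_simplex_labels hcell I).1) hU hconn
      (mult_pos A) hlat hyB⟩
  obtain ⟨B, hB, hBp⟩ := hexists
  refine ⟨B, ⟨hB, hBp⟩, fun B' ⟨hB', hBp'⟩ => ?_⟩
  obtain ⟨b, hb, hbpos⟩ := hgood B hB hBp
  obtain ⟨b', hb', hbpos'⟩ := hgood B' hB' hBp'
  have hmem : (fun k => p k + (1 / (r + 1 : ℝ)) * (-1)) ∈ (∑ I, B' I) ∩ ∑ I, B I := by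
    rw [cell_sum_eq (hS.cell B hB), cell_sum_eq (hS.cell B' hB')]
    refine ⟨(mem_sum_smul_simplex (mult_pos A)).2 ⟨b', hb', fun I j => ?_⟩,
      (mem_sum_smul_simplex (mult_pos A)).2 ⟨b, hb, fun I j => ?_⟩⟩
    · by_cases hj : j ∈ labels A B' I
      exacts [(hbpos' I j hj).le, (hb'.supp I j hj).ge]
    · by_cases hj : j ∈ labels A B I
      exacts [(hbpos I j hj).le, (hb.supp I j hj).ge]
  obtain ⟨h1, h2⟩ := hS.common_face B' hB' B hB
  have e1 : (∑ I, B' I) ∩ ∑ I, B I = ∑ I, B' I := by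
    rw [cell_sum_eq (hS.cell B' hB')] at h1 hmem ⊢
    exact isExposed_eq_of_coord_pos (mult_pos A) hb' hbpos' h1 hmem
  have e2 : (∑ I, B' I) ∩ ∑ I, B I = ∑ I, B I := by
    rw [cell_sum_eq (hS.cell B hB)] at h2 hmem ⊢
    exact isExposed_eq_of_coord_pos (mult_pos A) hb hbpos h2 hmem
  exact hS.distinct hB' hB (e1.symm.trans e2)
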